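/- Let $t,v,k,c,\lambda$ be positive integers with $t\le k$ and $ck\le v$. A splitting $t$-$(v,k\times c,\lambda)$ design is a pair $(X,\mathcal A)$ such that (i) $X$ is a set of $v$ elements (points); (ii) $\mathcal A$ is a set of $k\times c$ arrays (blocks) with entries from $X$, each point of $X$ occurring at most once in each block; (iii) for every set $\{x_1,\dots,x_t\}$ of $t$ distinct points of $X$ there are exactly $\lambda$ blocks in which $x_1,\dots,x_t$ occur in $t$ different rows. **Proposition.** For every integer $v>1$ with $v\equiv 1\pmod{150}$ and $v\neq 301$, there exists a splitting $2$-$(v,3\times 5,1)$ design. -/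

import Mathlib

/-- The points of the finite set `T` occur in pairwise different rows of the array `A`. -/
def OccurInDifferentRows {X : Type*} {k c : ℕ} (A : Matrix (Fin k) (Fin c) X)
    (T : Finset X) : Prop :=
  ∃ r : T → Fin k, Function.Injective r ∧ ∀ x : T, ∃ j : Fin c, A (r x) j = x

/-- `(X, 𝒜)` is a splitting `t`-`(v, k × c, l)` design: `X` is a set of `v` points, `𝒜` is a set
of `k × c` arrays (blocks) with entries from `X`, each point occurs at most once in each block,
and for every `t`-subset of `X` there are exactly `l` blocks in which its points occur in
`t` different rows. -/
structure IsSplittingDesign (t v k c l : ℕ) (X : Type*)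
    (𝒜 : Set (Matrix (Fin k) (Fin c) X)) : Prop where
  t_pos : 0 < t
  v_pos : 0 < v
  k_pos : 0 < k
  c_pos : 0 < c
  l_pos : 0 < l
  t_le_k : t ≤ k
  ck_le_v : c * k ≤ v
  card_points : Nat.card X = v
  occurs_at_most_once : ∀ A ∈ 𝒜, ∀ (i i' : Fin k) (j j' : Fin c),
    A i j = A i' j' → i = i' ∧ j = j'
  balanced : ∀ T : Finset X, T.card = t →
    {A | A ∈ 𝒜 ∧ OccurInDifferentRows A T}.ncard = l

/-! Write `v = 150 * u + 1`: take one point at infinity and `u` groups of `30 * 5` points. Decompose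
the complete multipartite graph with `u` parts of size 30 into triangles and replace each vertex by
five points: a triangle becomes a `3 × 5` array whose rows are the fibres of its vertices. These
arrays cover each pair from different groups once. Pairs within a group, or involving infinity, are
covered by a copy of a cyclic 151-point design on each group with infinity
(`HasTriangleDecomposition.hasSplittingFamily`).

The triangle decomposition (`HasTriangleDecomposition.thirty`) exists for all `u ≠ 0, 2`. Odd `u`
uses Bose's construction, with parts of size 3 enlarged tenfold; 4, 6 and 8 come from explicit
decompositions, enlarged likewise. The remaining even `u` are glued along a pairwise balanced design
whose blocks have odd size or size 4. -/

/-- The complete multipartite graph on `I × W` with parts `{i} × W` decomposes into triangles. -/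
def HasTriangleDecomposition (I W : Type) : Prop :=
  ∃ (β : Type) (b : β → Fin 3 → I × W),
    (∀ p, Function.Injective fun i => (b p i).1) ∧
    ∀ x y : I × W, x.1 ≠ y.1 → ∃! p, x ∈ Set.range (b p) ∧ y ∈ Set.range (b p)

/-- A family of `3 × 5` arrays on `X` with distinct entries such that any two distinct points occur
in different rows of exactly one array. -/
def HasSplittingFamily (X : Type) : Prop :=
  ∃ (β : Type) (B : β → Fin 3 → Fin 5 → X),
    (∀ p i i' j j', B p i j = B p i' j' → i = i' ∧ j = j') ∧
    ∀ x y, x ≠ y → ∃! p, ∃ i j i' j', i ≠ i' ∧ B p i j = x ∧ B p i' j' = y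

/-! ### Families of arrays and designs -/

theorem HasSplittingFamily.congr {X Y : Type} (e : X ≃ Y) (h : HasSplittingFamily X) :
    HasSplittingFamily Y := by
  obtain ⟨β, B, h1, h2⟩ := h
  refine ⟨β, fun p i j => e (B p i j), fun p i i' j j' h => h1 p i i' j j' (e.injective h), ?_⟩
  intro x y hxy
  have := h2 (e.symm x) (e.symm y) (fun h => hxy (e.symm.injective h))
  simpa only [← Equiv.eq_symm_apply] using this

theorem occurInDifferentRows_pair {X : Type} [DecidableEq X] {k c : ℕ}
    (A : Matrix (Fin k) (Fin c) X) {x y : X} (hxy : x ≠ y) :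
    OccurInDifferentRows A {x, y} ↔ ∃ i j i' j', i ≠ i' ∧ A i j = x ∧ A i' j' = y := by
  have hmem : ∀ a ∈ ({x, y} : Finset X), a = x ∨ a = y := fun a ha => by
    rwa [Finset.mem_insert, Finset.mem_singleton] at ha
  constructor
  · rintro ⟨r, hr, hA⟩
    obtain ⟨j, hj⟩ := hA ⟨x, Finset.mem_insert_self x _⟩
    obtain ⟨j', hj'⟩ := hA ⟨y, Finset.mem_insert_of_mem (Finset.mem_singleton_self y)⟩
    exact ⟨_, j, _, j', fun h => hxy (congrArg Subtype.val (hr h)), hj, hj'⟩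
  · rintro ⟨i, j, i', j', hi, hx, hy⟩
    refine ⟨fun z => if z.1 = x then i else i', ?_, ?_⟩
    · intro a b h
      dsimp only at h
      apply Subtype.ext
      by_cases ha : a.1 = x <;> by_cases hb : b.1 = x
      · rw [ha, hb]
      · rw [if_pos ha, if_neg hb] at h
        exact absurd h hi
      · rw [if_neg ha, if_pos hb] at h
        exact absurd h.symm hi
      · rw [(hmem _ a.2).resolve_left ha, (hmem _ b.2).resolve_left hb]
    · intro a
      by_cases ha : a.1 = x
      · exact ⟨j, (congrArg (A · j) (if_pos ha)).trans (hx.trans ha.symm)⟩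
      · exact ⟨j', (congrArg (A · j') (if_neg ha)).trans (hy.trans ((hmem _ a.2).resolve_left ha).symm)⟩

theorem HasSplittingFamily.isSplittingDesign {X : Type} {v : ℕ} (h : HasSplittingFamily X)
    (hv : 15 ≤ v) (hX : Nat.card X = v) :
    ∃ 𝒜 : Set (Matrix (Fin 3) (Fin 5) X), IsSplittingDesign 2 v 3 5 1 X 𝒜 := by
  obtain ⟨β, B, h1, h2⟩ := h
  refine ⟨Set.range B, by norm_num, by omega, by norm_num, by norm_num, by norm_num, by norm_num,
    by omega, hX, ?_, ?_⟩
  · rintro _ ⟨p, rfl⟩ i i' j j' h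
    exact h1 p i i' j j' h
  · intro T hT
    classical
    obtain ⟨x, y, hxy, rfl⟩ := Finset.card_eq_two.1 hT
    obtain ⟨p, hp, hu⟩ := h2 x y hxy
    have key := fun A : Matrix (Fin 3) (Fin 5) X => occurInDifferentRows_pair A hxy
    rw [Set.ncard_eq_one]
    refine ⟨B p, Set.ext fun A => ⟨?_, ?_⟩⟩
    · rintro ⟨⟨q, rfl⟩, hq⟩
      rw [hu q ((key _).1 hq)]
      rfl
    · rintro rfl
      exact ⟨⟨p, rfl⟩, (key _).2 hp⟩

/-! ### Recursive constructions -/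

namespace HasTriangleDecomposition

theorem congr {I J W V : Type} (e : I ≃ J) (f : W ≃ V) (h : HasTriangleDecomposition I W) :
    HasTriangleDecomposition J V := by
  obtain ⟨β, b, h1, h2⟩ := h
  refine ⟨β, fun p i => e.prodCongr f (b p i), fun p i j hij => h1 p (e.injective hij), ?_⟩
  intro x y hxy
  have := h2 ((e.prodCongr f).symm x) ((e.prodCongr f).symm y)
    (fun h => hxy (e.symm.injective h))
  simpa only [Set.mem_range, ← Equiv.eq_symm_apply] using this

/-- Two distinct parts lie in exactly one block, so the decompositions over the blocks never
overlap. -/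
theorem of_pairwise_balanced {I W κ : Type} (S : κ → Set I)
    (hS : ∀ i j, i ≠ j → ∃! k, i ∈ S k ∧ j ∈ S k)
    (h : ∀ k, HasTriangleDecomposition (S k) W) : HasTriangleDecomposition I W := by
  choose β b h1 h2 using h
  refine ⟨Σ k, β k, fun p i => ((b p.1 p.2 i).1.1, (b p.1 p.2 i).2),
    fun p i j hij => h1 p.1 p.2 (Subtype.ext hij), ?_⟩
  rintro ⟨x, w⟩ ⟨y, w'⟩ hxy
  obtain ⟨k, ⟨hx, hy⟩, hk⟩ := hS x y hxy
  obtain ⟨p, ⟨⟨i, hi⟩, ⟨j, hj⟩⟩, hp⟩ := h2 k (⟨x, hx⟩, w) (⟨y, hy⟩, w')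
    (fun h => hxy (congrArg Subtype.val h))
  refine ⟨⟨k, p⟩, ⟨⟨i, by simp [hi]⟩, ⟨j, by simp [hj]⟩⟩, ?_⟩
  rintro ⟨k', p'⟩ ⟨⟨i', hi'⟩, ⟨j', hj'⟩⟩
  simp only [Prod.mk.injEq] at hi' hj'
  obtain rfl : k' = k :=
    hk k' ⟨hi'.1 ▸ (b k' p' i').1.2, hj'.1 ▸ (b k' p' j').1.2⟩
  rw [hp p' ⟨⟨i', Prod.ext (Subtype.ext hi'.1) hi'.2⟩, ⟨j', Prod.ext (Subtype.ext hj'.1) hj'.2⟩⟩]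

/-- A triple with zero sum, given by its first two entries. -/
def zeroSumTriple {V : Type} [AddCommGroup V] (q : V × V) : Fin 3 → V :=
  ![q.1, q.2, -(q.1 + q.2)]

theorem existsUnique_zeroSumTriple {V : Type} [AddCommGroup V] (i j : Fin 3) (hij : i ≠ j)
    (u v : V) : ∃! q : V × V,
      zeroSumTriple q i = u ∧ zeroSumTriple q j = v := by
  have h01 : ∃! q : V × V, q.1 = u ∧ q.2 = v :=
    ⟨(u, v), by simp, fun q h => Prod.ext h.1 h.2⟩
  have h10 : ∃! q : V × V, q.2 = u ∧ q.1 = v :=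
    ⟨(v, u), by simp, fun q h => Prod.ext h.2 h.1⟩
  have h02 : ∃! q : V × V, q.1 = u ∧ -(q.1 + q.2) = v :=
    ⟨(u, -(u + v)), by simp, fun q h => Prod.ext h.1 (by dsimp only; rw [← h.2, ← h.1]; abel)⟩
  have h12 : ∃! q : V × V, q.2 = u ∧ -(q.1 + q.2) = v :=
    ⟨(-(u + v), u), by simp, fun q h => Prod.ext (by dsimp only; rw [← h.2, ← h.1]; abel) h.1⟩
  have h20 : ∃! q : V × V, -(q.1 + q.2) = u ∧ q.1 = v :=
    ⟨(v, -(u + v)), by simp, fun q h => Prod.ext h.2 (by dsimp only; rw [← h.2, ← h.1]; abel)⟩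
  have h21 : ∃! q : V × V, -(q.1 + q.2) = u ∧ q.2 = v :=
    ⟨(-(u + v), v), by simp, fun q h => Prod.ext (by dsimp only; rw [← h.2, ← h.1]; abel) h.2⟩
  fin_cases i <;> fin_cases j
  exacts [absurd rfl hij, h01, h02, h10, absurd rfl hij, h12, h20, h21, absurd rfl hij]

/-- Each triangle lifts along the Latin square of zero-sum triples, in which any two entries
determine the third. -/
theorem prod {I W : Type} (V : Type) [AddCommGroup V] (h : HasTriangleDecomposition I W) :
    HasTriangleDecomposition I (W × V) := by
  obtain ⟨β, b, h1, h2⟩ := h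
  refine ⟨β × V × V, fun p i => ((b p.1 i).1, (b p.1 i).2, zeroSumTriple p.2 i),
    fun p => h1 p.1, ?_⟩
  rintro ⟨x, w, u⟩ ⟨y, w', v⟩ hxy
  obtain ⟨p, ⟨⟨i, hi⟩, ⟨j, hj⟩⟩, hp⟩ := h2 (x, w) (y, w') hxy
  have hij : i ≠ j := by
    rintro rfl
    exact hxy (congrArg (fun z : I × W => z.1) (hi.symm.trans hj))
  obtain ⟨q, ⟨hq1, hq2⟩, hq⟩ := existsUnique_zeroSumTriple i j hij u v
  refine ⟨(p, q), ⟨⟨i, by simp [hi, hq1]⟩, ⟨j, by simp [hj, hq2]⟩⟩, ?_⟩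
  rintro ⟨p', q'⟩ ⟨⟨i', hi'⟩, ⟨j', hj'⟩⟩
  simp only [Prod.mk.injEq] at hi' hj'
  obtain rfl : p' = p := hp p' ⟨⟨i', Prod.ext hi'.1 hi'.2.1⟩, ⟨j', Prod.ext hj'.1 hj'.2.1⟩⟩
  obtain rfl : i' = i := h1 p' (by simp [hi, hi'.1])
  obtain rfl : j' = j := h1 p' (by simp [hj, hj'.1])
  rw [hq q' ⟨hi'.2.2, hj'.2.2⟩]

theorem hasSplittingFamily {I W : Type} (h : HasTriangleDecomposition I W)
    (h' : HasSplittingFamily (Option (W × Fin 5))) :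
    HasSplittingFamily (Option (I × W × Fin 5)) := by
  obtain ⟨β, b, h1, h2⟩ := h
  obtain ⟨γ, B, k1, k2⟩ := h'
  have minj : ∀ i : I, Function.Injective (Option.map fun w : W × Fin 5 => (i, w)) :=
    fun i => Option.map_injective (Prod.mk_right_injective i)
  let D : β ⊕ I × γ → Fin 3 → Fin 5 → Option (I × W × Fin 5) := fun p r c =>
    Sum.elim (fun p => some ((b p r).1, (b p r).2, c))
      (fun q => (B q.2 r c).map fun w => (q.1, w)) p
  -- A pair inside one group with infinity meets no inflated triangle in different rows, since those
  -- rows lie in different groups.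
  have same : ∀ (i : I) (x y : Option (W × Fin 5)), x ≠ y →
      ∃! p, ∃ r c r' c', r ≠ r' ∧ D p r c = x.map (fun w => (i, w)) ∧
        D p r' c' = y.map (fun w => (i, w)) := by
    intro i x y hxy
    obtain ⟨q, ⟨r, c, r', c', hr, hx, hy⟩, hq⟩ := k2 x y hxy
    refine ⟨Sum.inr (i, q), ⟨r, c, r', c', hr, by simp [D, hx], by simp [D, hy]⟩, ?_⟩
    rintro (p | ⟨i', q'⟩) ⟨s, d, s', d', hs, hx', hy'⟩
    · exfalso
      cases x <;> cases y <;> simp [D] at hx' hy'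
      exact hs (h1 p (hx'.1.trans hy'.1.symm))
    -- Infinity lies in every copy, so the group is read off from whichever point is finite.
    · obtain rfl : i' = i := by
        simp only [D, Sum.elim_inr] at hx' hy'
        rcases x with _ | x
        · rcases y with _ | y
          · exact absurd rfl hxy
          · obtain ⟨_, _, h⟩ := Option.map_eq_some_iff.1 hy'
            exact congrArg Prod.fst h
        · obtain ⟨_, _, h⟩ := Option.map_eq_some_iff.1 hx'
          exact congrArg Prod.fst h
      rw [hq q' ⟨s, d, s', d', hs, minj i' hx', minj i' hy'⟩]
  refine ⟨β ⊕ I × γ, D, ?_, ?_⟩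
  · rintro (p | ⟨i, q⟩) r r' c c' h
    · simp only [D, Sum.elim_inl, Option.some.injEq, Prod.mk.injEq] at h
      exact ⟨h1 p h.1, h.2.2⟩
    · exact k1 q r r' c c' (minj i h)
  · rintro (_ | ⟨i, w⟩) (_ | ⟨j, w'⟩) hxy
    · exact absurd rfl hxy
    · exact same j none (some w') (by simp)
    · exact same i (some w) none (by simp)
    · by_cases hij : i = j
      · subst hij
        exact same i (some w) (some w') (by rintro h; simp_all)
      · obtain ⟨w, c⟩ := w
        obtain ⟨w', c'⟩ := w'
        obtain ⟨p, ⟨⟨r, hr⟩, ⟨r', hr'⟩⟩, hp⟩ := h2 (i, w) (j, w') hij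
        refine ⟨Sum.inl p, ⟨r, c, r', c', ?_, by simp [D, hr], by simp [D, hr']⟩, ?_⟩
        · rintro rfl
          exact hij (congrArg Prod.fst (hr.symm.trans hr'))
        · rintro (p' | ⟨i', q'⟩) ⟨s, d, s', d', hs, hx, hy⟩
          · simp only [D, Sum.elim_inl, Option.some.injEq, Prod.mk.injEq] at hx hy
            rw [hp p' ⟨⟨s, Prod.ext hx.1 hx.2.1⟩, ⟨s', Prod.ext hy.1 hy.2.1⟩⟩]
          · simp only [D, Sum.elim_inr] at hx hy
            obtain ⟨_, _, h⟩ := Option.map_eq_some_iff.1 hx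
            obtain ⟨_, _, h'⟩ := Option.map_eq_some_iff.1 hy
            exact absurd ((Prod.mk.inj h).1.symm.trans (Prod.mk.inj h').1) hij

end HasTriangleDecomposition

/-! ### Difference families -/

theorem existsUnique_translate {G σ κ : Type} [AddCommGroup G] (b : σ → κ → G) (R : κ → κ → Prop)
    (x y : G) (h : ∃! t : σ × κ × κ, R t.2.1 t.2.2 ∧ b t.1 t.2.1 - b t.1 t.2.2 = x - y) :
    ∃! p : G × σ, ∃ k k', R k k' ∧ p.1 + b p.2 k = x ∧ p.1 + b p.2 k' = y := by
  obtain ⟨⟨s, k, k'⟩, ⟨hR, hd⟩, hu⟩ := h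
  simp only at hR hd
  refine ⟨(x - b s k, s), ⟨k, k', hR, by simp, ?_⟩, ?_⟩
  · rw [sub_add, hd, sub_sub_cancel]
  · rintro ⟨g, s'⟩ ⟨l, l', hl, hx, hy⟩
    simp only at hx hy
    have := hu (s', l, l') ⟨hl, by rw [← hx, ← hy]; abel⟩
    simp only [Prod.mk.injEq] at this
    obtain ⟨rfl, rfl, rfl⟩ := this
    rw [← hx, add_sub_cancel_right]

/-- Three pairs of rows give `2 * 3 * 25 = 150` differences, as many as the nonzero residues. -/
def baseArray151 : Fin 3 → Fin 5 → ZMod 151 :=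
  ![![0, 1, 2, 3, 4], ![5, 13, 59, 105, 118], ![28, 67, 73, 112, 134]]

theorem baseArray151_difference : ∀ d : ZMod 151, d ≠ 0 →
    ∃! t : Unit × (Fin 3 × Fin 5) × (Fin 3 × Fin 5), t.2.1.1 ≠ t.2.2.1 ∧
      baseArray151 t.2.1.1 t.2.1.2 - baseArray151 t.2.2.1 t.2.2.2 = d := by
  unfold ExistsUnique
  decide +kernel

theorem hasSplittingFamily_zmod_151 : HasSplittingFamily (ZMod 151) := by
  refine ⟨ZMod 151 × Unit, fun p i j => p.1 + baseArray151 i j, ?_, ?_⟩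
  · intro p i i' j j' h
    have : ∀ i i' j j', baseArray151 i j = baseArray151 i' j' → i = i' ∧ j = j' := by
      decide +kernel
    exact this i i' j j' (add_left_cancel h)
  · intro x y hxy
    have := existsUnique_translate (σ := Unit) (fun _ (k : Fin 3 × Fin 5) => baseArray151 k.1 k.2)
      (fun k k' => k.1 ≠ k'.1) x y (baseArray151_difference _ (sub_ne_zero.2 hxy))
    simpa only [Prod.exists] using this

/-- The parts are the cosets of the multiples of 8; the `7 * 6 = 42` differences are the residues
outside that subgroup. -/
def baseTriples48 : Fin 7 → Fin 3 → ZMod 48 :=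
  ![![0, 1, 23], ![0, 2, 21], ![0, 5, 20], ![0, 6, 18], ![0, 7, 17], ![0, 3, 14], ![0, 4, 13]]

theorem baseTriples48_difference : ∀ d : ZMod 48, (d.cast : ZMod 8) ≠ 0 →
    ∃! t : Fin 7 × Fin 3 × Fin 3, t.2.1 ≠ t.2.2 ∧
      baseTriples48 t.1 t.2.1 - baseTriples48 t.1 t.2.2 = d := by
  unfold ExistsUnique
  decide +kernel

def zmod48Coords (x : ZMod 48) : ZMod 8 × Fin 6 := (x.cast, Fin.ofNat 6 (x.val / 8))

theorem zmod48Coords_bijective : Function.Bijective zmod48Coords := by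
  have : Function.Injective zmod48Coords := by
    unfold Function.Injective
    decide +kernel
  exact (Fintype.bijective_iff_injective_and_card _).2 ⟨this, rfl⟩

namespace HasTriangleDecomposition

theorem eight_six : HasTriangleDecomposition (ZMod 8) (Fin 6) := by
  have cast_sub : ∀ x y : ZMod 48, ((x - y).cast : ZMod 8) = x.cast - y.cast :=
    fun x y => ZMod.cast_sub (by norm_num) x y
  have cast_add : ∀ x y : ZMod 48, ((x + y).cast : ZMod 8) = x.cast + y.cast :=
    fun x y => ZMod.cast_add (by norm_num) x y
  refine ⟨ZMod 48 × Fin 7, fun p i => zmod48Coords (p.1 + baseTriples48 p.2 i), ?_, ?_⟩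
  · rintro ⟨g, s⟩ i j h
    simp only [zmod48Coords, cast_add, add_right_inj] at h
    have : ∀ s i j, ((baseTriples48 s i).cast : ZMod 8) = (baseTriples48 s j).cast → i = j := by
      decide +kernel
    exact this s i j h
  · intro x y hxy
    obtain ⟨x, rfl⟩ := zmod48Coords_bijective.2 x
    obtain ⟨y, rfl⟩ := zmod48Coords_bijective.2 y
    have hne : x ≠ y := fun h => hxy (by rw [h])
    obtain ⟨p, ⟨k, k', hk, hx, hy⟩, hu⟩ := existsUnique_translate baseTriples48 (· ≠ ·) x y
      (baseTriples48_difference _ (by rw [cast_sub]; exact sub_ne_zero.2 hxy))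
    refine ⟨p, ⟨⟨k, congrArg _ hx⟩, ⟨k', congrArg _ hy⟩⟩, ?_⟩
    rintro q ⟨⟨l, hl⟩, ⟨l', hl'⟩⟩
    have hl := zmod48Coords_bijective.1 hl
    have hl' := zmod48Coords_bijective.1 hl'
    refine hu q ⟨l, l', ?_, hl, hl'⟩
    rintro rfl
    exact hne (hl.symm.trans hl')

/-! ### Small even numbers of parts -/

def triples4 : Fin 8 → Fin 3 → Fin 4 × Fin 2 :=
  ![![(0, 0), (1, 0), (2, 1)], ![(0, 0), (2, 0), (3, 1)], ![(0, 0), (1, 1), (3, 0)],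
    ![(0, 1), (1, 0), (3, 1)], ![(0, 1), (1, 1), (2, 0)], ![(0, 1), (2, 1), (3, 0)],
    ![(1, 0), (2, 0), (3, 0)], ![(1, 1), (2, 1), (3, 1)]]

theorem four_two : HasTriangleDecomposition (Fin 4) (Fin 2) := by
  refine ⟨Fin 8, triples4, ?_, ?_⟩
  · unfold Function.Injective
    decide +kernel
  · unfold ExistsUnique Set.range
    simp only [Set.mem_ofPred_eq]
    decide +kernel

def triples6 : Fin 20 → Fin 3 → Fin 6 × Fin 2 :=
  ![![(0, 0), (1, 0), (4, 0)], ![(0, 0), (2, 1), (5, 0)], ![(1, 0), (2, 0), (5, 0)],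
    ![(0, 1), (1, 0), (3, 0)], ![(0, 1), (1, 1), (5, 0)], ![(3, 1), (4, 0), (5, 0)],
    ![(0, 1), (2, 1), (4, 0)], ![(0, 1), (2, 0), (4, 1)], ![(2, 0), (3, 0), (4, 0)],
    ![(1, 1), (4, 0), (5, 1)], ![(1, 1), (2, 0), (3, 1)], ![(1, 1), (2, 1), (4, 1)],
    ![(0, 0), (1, 1), (3, 0)], ![(2, 1), (3, 0), (5, 1)], ![(1, 0), (2, 1), (3, 1)],
    ![(3, 0), (4, 1), (5, 0)], ![(0, 0), (3, 1), (4, 1)], ![(0, 1), (3, 1), (5, 1)],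
    ![(1, 0), (4, 1), (5, 1)], ![(0, 0), (2, 0), (5, 1)]]

theorem six_two : HasTriangleDecomposition (Fin 6) (Fin 2) := by
  refine ⟨Fin 20, triples6, ?_, ?_⟩
  · unfold Function.Injective
    decide +kernel
  · unfold ExistsUnique Set.range
    simp only [Set.mem_ofPred_eq]
    decide +kernel

/-- The Klein four-group's Latin square gives 16 triples on three groups of size 4. Points 12 and 13
extend two transversals sharing only `{0, 4, 8}`; the groups are the last three blocks. -/
def blocks14 : Fin 19 → Finset (Fin 14) :=
  ![{0, 4, 8, 12, 13}, {0, 5, 9}, {0, 6, 10}, {0, 7, 11}, {1, 4, 9}, {1, 5, 8}, {1, 6, 11, 13},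
    {1, 7, 10, 12}, {2, 4, 10}, {2, 5, 11, 12}, {2, 6, 8}, {2, 7, 9, 13}, {3, 4, 11},
    {3, 5, 10, 13}, {3, 6, 9, 12}, {3, 7, 8}, {0, 1, 2, 3}, {4, 5, 6, 7}, {8, 9, 10, 11}]

theorem blocks14_card : ∀ k, (blocks14 k).card = 3 ∨ (blocks14 k).card = 4 ∨
    (blocks14 k).card = 5 := by
  decide +kernel

theorem blocks14_pair : ∀ i j, i ≠ j → ∃! k, i ∈ blocks14 k ∧ j ∈ blocks14 k := by
  unfold ExistsUnique
  decide +kernel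

end HasTriangleDecomposition

/-! ### Odd numbers of parts -/

namespace HasTriangleDecomposition

/-- Bose's construction: join `(x, a)` and `(y, a)` to their midpoint on level `a + 1`, which makes
sense because 2 is invertible. -/
theorem of_odd {u : ℕ} (hu : Odd u) : HasTriangleDecomposition (ZMod u) (ZMod 3) := by
  have : NeZero u := ⟨hu.pos.ne'⟩
  obtain ⟨h, hh⟩ : ∃ h : ZMod u, 2 * h = 1 := by
    obtain ⟨n, hn⟩ := hu
    refine ⟨(n : ZMod u) + 1, ?_⟩
    have : ((2 * n + 1 : ℕ) : ZMod u) = 0 := by rw [← hn]; exact ZMod.natCast_self u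
    push_cast at this
    linear_combination this
  have val_ne : ∀ {x y : ZMod u}, x.val < y.val → x ≠ y := fun h e => h.ne (congrArg _ e)
  have hmid : ∀ {x y z : ZMod u}, h * (x + y) = z ↔ y = 2 * z - x := by
    intro x y z
    constructor
    · intro e
      linear_combination 2 * e - (x + y) * hh
    · rintro rfl
      linear_combination z * hh
  have one_ne : ∀ a : ZMod 3, a + 1 ≠ a := by decide
  have two_ne : ∀ a : ZMod 3, a + 1 + 1 ≠ a := by decide
  -- Comparing `val` lists each unordered pair once.
  let b : {q : (ZMod u × ZMod u) × ZMod 3 // q.1.1.val < q.1.2.val} → Fin 3 → ZMod u × ZMod 3 :=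
    fun p => ![(p.1.1.1, p.1.2), (p.1.1.2, p.1.2), (h * (p.1.1.1 + p.1.1.2), p.1.2 + 1)]
  have hmem : ∀ p z, z ∈ Set.range (b p) ↔ z = (p.1.1.1, p.1.2) ∨ z = (p.1.1.2, p.1.2) ∨
      z = (h * (p.1.1.1 + p.1.1.2), p.1.2 + 1) := by
    intro p z
    constructor
    · rintro ⟨i, rfl⟩
      fin_cases i
      exacts [Or.inl rfl, Or.inr (Or.inl rfl), Or.inr (Or.inr rfl)]
    · rintro (rfl | rfl | rfl)
      exacts [⟨0, rfl⟩, ⟨1, rfl⟩, ⟨2, rfl⟩]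
  refine ⟨_, b, ?_, ?_⟩
  · intro p
    have h01 := val_ne p.2
    have h02 : p.1.1.1 ≠ h * (p.1.1.1 + p.1.1.2) := fun e => h01 (by
      rw [hmid.1 e.symm]; ring)
    have h12 : p.1.1.2 ≠ h * (p.1.1.1 + p.1.1.2) := fun e => h01 (by
      linear_combination hmid.1 e.symm)
    intro i j hij
    fin_cases i <;> fin_cases j
    exacts [rfl, absurd hij h01, absurd hij h02, absurd hij.symm h01, rfl, absurd hij h12,
      absurd hij.symm h02, absurd hij.symm h12, rfl]
  · have same_lt : ∀ (x y : ZMod u) (a : ZMod 3), x.val < y.val →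
        ∃! p, (x, a) ∈ Set.range (b p) ∧ (y, a) ∈ Set.range (b p) := by
      intro x y a hxy
      have hne := val_ne hxy
      refine ⟨⟨((x, y), a), hxy⟩, ⟨(hmem _ _).2 (Or.inl rfl), (hmem _ _).2 (Or.inr (Or.inl rfl))⟩, ?_⟩
      rintro ⟨⟨⟨x', y'⟩, c⟩, hlt⟩ ⟨h1, h2⟩
      rw [hmem] at h1 h2
      simp only [Prod.mk.injEq] at h1 h2 hlt
      rcases h1 with ⟨rfl, rfl⟩ | ⟨rfl, rfl⟩ | ⟨rfl, rfl⟩ <;>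
        rcases h2 with ⟨rfl, e⟩ | ⟨rfl, e⟩ | ⟨rfl, e⟩
      · exact absurd rfl hne
      · rfl
      · exact absurd e.symm (one_ne _)
      · exact absurd hxy hlt.asymm
      · exact absurd rfl hne
      · exact absurd e.symm (one_ne _)
      · exact absurd e (one_ne _)
      · exact absurd e (one_ne _)
      · exact absurd rfl hne
    have succ : ∀ (x y : ZMod u) (a : ZMod 3), x ≠ y →
        ∃! p, (x, a) ∈ Set.range (b p) ∧ (y, a + 1) ∈ Set.range (b p) := by
      intro x y a hxy
      -- The third vertex must be the reflection of `x` in `y`.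
      have hne : x ≠ 2 * y - x := fun e => hxy (by
        linear_combination h * e + (y - x) * hh)
      have huniq : ∀ p, (x, a) ∈ Set.range (b p) → (y, a + 1) ∈ Set.range (b p) →
          p.1.2 = a ∧ (p.1.1 = (x, 2 * y - x) ∨ p.1.1 = (2 * y - x, x)) := by
        rintro ⟨⟨⟨x', y'⟩, c⟩, hlt⟩ h1 h2
        rw [hmem] at h1 h2
        simp only [Prod.mk.injEq] at h1 h2 ⊢
        have hc : c = a := by
          rcases h1 with ⟨-, e⟩ | ⟨-, e⟩ | ⟨-, e⟩
          · exact e.symm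
          · exact e.symm
          · rcases h2 with ⟨-, e'⟩ | ⟨-, e'⟩ | ⟨-, e'⟩
            · exact absurd (by rw [e', ← e]) (two_ne a)
            · exact absurd (by rw [e', ← e]) (two_ne a)
            · exact (add_right_cancel e').symm
        subst hc
        have hy : y = h * (x' + y') := by
          rcases h2 with ⟨-, e'⟩ | ⟨-, e'⟩ | ⟨e', -⟩
          · exact absurd e' (one_ne _)
          · exact absurd e' (one_ne _)
          · exact e'
        have hy' := hmid.1 hy.symm
        refine ⟨rfl, ?_⟩
        rcases h1 with ⟨rfl, -⟩ | ⟨rfl, -⟩ | ⟨-, e⟩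
        · exact Or.inl ⟨rfl, hy'⟩
        · exact Or.inr ⟨by rw [hy']; ring, rfl⟩
        · exact absurd e.symm (one_ne _)
      have hmid1 : y = h * (x + (2 * y - x)) := (hmid.2 rfl).symm
      have hmid2 : y = h * (2 * y - x + x) := by rw [add_comm]; exact hmid1
      rcases lt_trichotomy x.val (2 * y - x).val with hlt | heq | hlt
      · refine ⟨⟨((x, 2 * y - x), a), hlt⟩, ⟨(hmem _ _).2 (Or.inl rfl),
          (hmem _ _).2 (Or.inr (Or.inr (Prod.ext hmid1 rfl)))⟩, ?_⟩
        rintro ⟨⟨p, c⟩, hp⟩ ⟨h1, h2⟩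
        obtain ⟨rfl, rfl | rfl⟩ := huniq _ h1 h2
        · rfl
        · exact absurd hlt hp.asymm
      · exact absurd (ZMod.val_injective u heq) hne
      · refine ⟨⟨((2 * y - x, x), a), hlt⟩, ⟨(hmem _ _).2 (Or.inr (Or.inl rfl)),
          (hmem _ _).2 (Or.inr (Or.inr (Prod.ext hmid2 rfl)))⟩, ?_⟩
        rintro ⟨⟨p, c⟩, hp⟩ ⟨h1, h2⟩
        obtain ⟨rfl, rfl | rfl⟩ := huniq _ h1 h2
        · exact absurd hlt hp.asymm
        · rfl
    rintro ⟨x, a⟩ ⟨y, a'⟩ (hxy : x ≠ y)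
    have hcases : ∀ a a' : ZMod 3, a' = a ∨ a' = a + 1 ∨ a = a' + 1 := by decide
    rcases hcases a a' with rfl | rfl | rfl
    · rcases lt_trichotomy x.val y.val with hlt | heq | hlt
      · exact same_lt x y a' hlt
      · exact absurd (ZMod.val_injective u heq) hxy
      · simpa only [and_comm] using same_lt y x a' hlt
    · exact succ x y a hxy
    · simpa only [and_comm] using succ y x a' hxy.symm

theorem of_card_eq {I J W V : Type} [Finite I] [Finite J] [Finite W] [Finite V]
    (h : HasTriangleDecomposition J W) (hI : Nat.card J = Nat.card I)
    (hW : Nat.card W = Nat.card V) : HasTriangleDecomposition I V := by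
  obtain ⟨e⟩ := Finite.card_eq.1 hI
  obtain ⟨f⟩ := Finite.card_eq.1 hW
  exact h.congr e f

theorem thirty_of_odd {I : Type} (hI : Odd (Nat.card I)) :
    HasTriangleDecomposition I (Fin 30) := by
  have : Finite I := Nat.finite_of_card_ne_zero hI.pos.ne'
  have : NeZero (Nat.card I) := ⟨hI.pos.ne'⟩
  exact ((of_odd hI).prod (ZMod 10)).of_card_eq (by simp) (by simp)

theorem thirty_of_four {I : Type} (hI : Nat.card I = 4) : HasTriangleDecomposition I (Fin 30) := by
  have : Finite I := Nat.finite_of_card_ne_zero (by simp [hI])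
  exact (four_two.prod (ZMod 15)).of_card_eq (by simp [hI]) (by simp)

theorem thirty_of_six {I : Type} (hI : Nat.card I = 6) : HasTriangleDecomposition I (Fin 30) := by
  have : Finite I := Nat.finite_of_card_ne_zero (by simp [hI])
  exact (six_two.prod (ZMod 15)).of_card_eq (by simp [hI]) (by simp)

theorem thirty_of_eight {I : Type} (hI : Nat.card I = 8) :
    HasTriangleDecomposition I (Fin 30) := by
  have : Finite I := Nat.finite_of_card_ne_zero (by simp [hI])
  exact (eight_six.prod (ZMod 5)).of_card_eq (by simp [hI]) (by simp)

theorem thirty_of_fourteen {I : Type} (hI : Nat.card I = 14) :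
    HasTriangleDecomposition I (Fin 30) := by
  have : Finite I := Nat.finite_of_card_ne_zero (by simp [hI])
  have h : HasTriangleDecomposition (Fin 14) (Fin 30) := by
    refine of_pairwise_balanced (fun k => (blocks14 k : Set (Fin 14))) blocks14_pair fun k => ?_
    have hk : Nat.card (blocks14 k : Set (Fin 14)) = (blocks14 k).card := by simp
    rcases blocks14_card k with h | h | h <;> rw [h] at hk
    · exact thirty_of_odd (hk ▸ by decide)
    · exact thirty_of_four hk
    · exact thirty_of_odd (hk ▸ by decide)
  exact h.of_card_eq (by simp [hI]) rfl

/-! ### Truncated transversal designs -/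

/-- A column of an orthogonal array of strength two over `ZMod m`, `m` odd. -/
def orthogonalColumn {m : ℕ} (q : ZMod m × ZMod m) : Fin 4 → ZMod m :=
  ![q.1, q.2, q.1 + q.2, q.1 + 2 * q.2]

/-- Any two of the four linear forms have determinant `±1` or `±2`, a unit for odd `m`. -/
theorem existsUnique_orthogonalColumn {m : ℕ} (hm : Odd m) {i j : Fin 4} (hij : i ≠ j)
    (u v : ZMod m) : ∃! q, orthogonalColumn q i = u ∧ orthogonalColumn q j = v := by
  obtain ⟨h, hh⟩ : ∃ h : ZMod m, 2 * h = 1 := by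
    obtain ⟨n, hn⟩ := hm
    refine ⟨(n : ZMod m) + 1, ?_⟩
    have : ((2 * n + 1 : ℕ) : ZMod m) = 0 := by rw [← hn]; exact ZMod.natCast_self m
    push_cast at this
    linear_combination this
  wlog hlt : i < j generalizing i j u v
  · simpa only [and_comm] using
      this hij.symm v u (lt_of_le_of_ne (not_lt.1 hlt) hij.symm)
  have h01 : ∃! q : ZMod m × ZMod m, q.1 = u ∧ q.2 = v :=
    ⟨(u, v), by simp, fun q e => Prod.ext e.1 e.2⟩
  have h02 : ∃! q : ZMod m × ZMod m, q.1 = u ∧ q.1 + q.2 = v :=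
    ⟨(u, v - u), by simp, fun q e => Prod.ext e.1 (by linear_combination e.2 - e.1)⟩
  have h03 : ∃! q : ZMod m × ZMod m, q.1 = u ∧ q.1 + 2 * q.2 = v :=
    ⟨(u, h * (v - u)), ⟨rfl, by linear_combination (v - u) * hh⟩,
      fun q e => Prod.ext e.1 (by linear_combination h * e.2 - h * e.1 - q.2 * hh)⟩
  have h12 : ∃! q : ZMod m × ZMod m, q.2 = u ∧ q.1 + q.2 = v :=
    ⟨(v - u, u), by simp, fun q e => Prod.ext (by linear_combination e.2 - e.1) e.1⟩
  have h13 : ∃! q : ZMod m × ZMod m, q.2 = u ∧ q.1 + 2 * q.2 = v :=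
    ⟨(v - 2 * u, u), by simp, fun q e => Prod.ext (by linear_combination e.2 - 2 * e.1) e.1⟩
  have h23 : ∃! q : ZMod m × ZMod m, q.1 + q.2 = u ∧ q.1 + 2 * q.2 = v :=
    ⟨(2 * u - v, v - u), ⟨by ring, by ring⟩, fun q e =>
      Prod.ext (by linear_combination 2 * e.1 - e.2) (by linear_combination e.2 - e.1)⟩
  fin_cases i <;> fin_cases j
  exacts [absurd rfl hij, h01, h02, h03, absurd hlt (by decide), absurd rfl hij, h12, h13,
    absurd hlt (by decide), absurd hlt (by decide), absurd rfl hij, h23,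
    absurd hlt (by decide), absurd hlt (by decide), absurd hlt (by decide), absurd rfl hij]

/-- The points of a transversal design with three groups of size `m` and one truncated to size
`r`. -/
abbrev TruncatedPoint (m r : ℕ) : Type := {q : Fin 4 × ZMod m // q.1 = 3 → q.2.val < r}

theorem card_val_lt {m r : ℕ} [NeZero m] (hr : r ≤ m) :
    Nat.card {x : ZMod m // x.val < r} = r := by
  let e : {x : ZMod m // x.val < r} ≃ Fin r :=
    { toFun := fun x => ⟨x.1.val, x.2⟩
      invFun := fun k => ⟨(k.1 : ZMod m), by
        rw [ZMod.val_natCast_of_lt (k.2.trans_le hr)]; exact k.2⟩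
      left_inv := fun x => Subtype.ext (ZMod.natCast_zmod_val x.1)
      right_inv := fun k => Fin.ext (ZMod.val_natCast_of_lt (k.2.trans_le hr)) }
  exact (Nat.card_congr e).trans (Nat.card_fin r)

theorem card_truncated_group {m r : ℕ} [NeZero m] (hr : r ≤ m) (i : Fin 4) :
    Nat.card {x : ZMod m // i = 3 → x.val < r} = if i = 3 then r else m := by
  split_ifs with hi
  · simp only [hi, true_imp_iff]
    exact card_val_lt hr
  · simp [hi]

theorem card_truncatedPoint {m r : ℕ} [NeZero m] (hr : r ≤ m) :
    Nat.card (TruncatedPoint m r) = 3 * m + r := by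
  rw [Nat.card_congr (Equiv.subtypeProdEquivSigmaSubtype
    fun (i : Fin 4) (x : ZMod m) => i = 3 → x.val < r), Nat.card_sigma]
  simp only [card_truncated_group hr, Fin.sum_univ_four]
  simp
  ring

theorem card_group {m r : ℕ} [NeZero m] (hr : r ≤ m) (i : Fin 4) :
    Nat.card {q : TruncatedPoint m r | q.1.1 = i} = if i = 3 then r else m := by
  rw [← card_truncated_group hr i]
  exact Nat.card_congr
    { toFun := fun q => ⟨q.1.1.2, fun h => q.1.2 (q.2.trans h)⟩
      invFun := fun x => ⟨⟨(i, x.1), x.2⟩, rfl⟩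
      left_inv := by
        rintro ⟨⟨⟨j, x⟩, h⟩, rfl⟩
        rfl
      right_inv := fun x => rfl }

theorem card_line {m r : ℕ} (f : Fin 4 → ZMod m) :
    Nat.card {q : TruncatedPoint m r | q.1.2 = f q.1.1} = 3 ∨
      Nat.card {q : TruncatedPoint m r | q.1.2 = f q.1.1} = 4 := by
  have e : {q : TruncatedPoint m r | q.1.2 = f q.1.1} ≃ {i : Fin 4 // i = 3 → (f i).val < r} :=
    { toFun := fun q => ⟨q.1.1.1, fun h => q.2 ▸ q.1.2 h⟩
      invFun := fun i => ⟨⟨(i.1, f i.1), i.2⟩, rfl⟩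
      left_inv := fun q => Subtype.ext (Subtype.ext (Prod.ext rfl (Eq.symm q.2)))
      right_inv := fun i => rfl }
  rw [Nat.card_congr e]
  by_cases h : (f 3).val < r
  · right
    have : ∀ i : Fin 4, i = 3 → (f i).val < r := by rintro _ rfl; exact h
    rw [Nat.card_congr (Equiv.subtypeUnivEquiv this), Nat.card_fin]
  · left
    have : ∀ i : Fin 4, (i = 3 → (f i).val < r) ↔ i ≠ 3 :=
      fun i => ⟨fun hi e => h (e ▸ hi e), fun hi e => absurd e hi⟩
    simp only [this]
    simp

/-- Groups and truncated lines form a pairwise balanced design: groups have odd size, lines have 3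
or 4 points. -/
theorem thirty_of_truncated {I : Type} {m r : ℕ} (hm : Odd m) (hr : Odd r) (hrm : r ≤ m)
    (hI : Nat.card I = 3 * m + r) : HasTriangleDecomposition I (Fin 30) := by
  have : NeZero m := ⟨hm.pos.ne'⟩
  have : Finite I := Nat.finite_of_card_ne_zero (by have := hm.pos; omega)
  refine of_card_eq (J := TruncatedPoint m r) (W := Fin 30) ?_
    ((card_truncatedPoint hrm).trans hI.symm) rfl
  refine of_pairwise_balanced (κ := Fin 4 ⊕ ZMod m × ZMod m)
    (Sum.elim (fun i => {q | q.1.1 = i}) fun c => {q | q.1.2 = orthogonalColumn c q.1.1}) ?_ ?_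
  · rintro ⟨⟨i, x⟩, hx⟩ ⟨⟨j, y⟩, hy⟩ hne
    by_cases hij : i = j
    · subst hij
      refine ⟨Sum.inl i, ⟨rfl, rfl⟩, ?_⟩
      rintro (k | c) ⟨h1, h2⟩
      · exact congrArg Sum.inl (Eq.symm h1)
      · have h1 : x = orthogonalColumn c i := h1
        have h2 : y = orthogonalColumn c i := h2
        exact (hne (Subtype.ext (Prod.ext rfl (h1.trans h2.symm)))).elim
    · obtain ⟨c, ⟨h1, h2⟩, hc⟩ := existsUnique_orthogonalColumn hm hij x y
      refine ⟨Sum.inr c, ⟨h1.symm, h2.symm⟩, ?_⟩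
      rintro (k | c') ⟨h1', h2'⟩
      · exact absurd (Eq.trans h1' (Eq.symm h2')) hij
      · exact congrArg Sum.inr (hc c' ⟨Eq.symm h1', Eq.symm h2'⟩)
  · rintro (i | c)
    · refine thirty_of_odd ?_
      simp only [Sum.elim_inl]
      rw [card_group hrm i]
      split_ifs
      exacts [hr, hm]
    · rcases card_line (r := r) (orthogonalColumn c) with h | h
      · exact thirty_of_odd (by simp only [Sum.elim_inr]; rw [h]; decide)
      · exact thirty_of_four h

theorem thirty {I : Type} (h0 : Nat.card I ≠ 0) (h2 : Nat.card I ≠ 2) :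
    HasTriangleDecomposition I (Fin 30) := by
  generalize hn : Nat.card I = n at h0 h2
  rcases Nat.even_or_odd n with he | ho
  swap
  · exact thirty_of_odd (hn ▸ ho)
  rw [Nat.even_iff] at he
  by_cases h4 : n = 4
  · exact thirty_of_four (hn.trans h4)
  by_cases h6 : n = 6
  · exact thirty_of_six (hn.trans h6)
  by_cases h8 : n = 8
  · exact thirty_of_eight (hn.trans h8)
  by_cases h14 : n = 14
  · exact thirty_of_fourteen (hn.trans h14)
  -- The residue of `n` mod 3 dictates `r`; `r = 5` needs `n ≥ 20`, hence the separate treatment of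
  -- 8 and 14.
  obtain ⟨m, r, hm, hr, hrm, e⟩ : ∃ m r, m % 2 = 1 ∧ r % 2 = 1 ∧ r ≤ m ∧ n = 3 * m + r := by
    have : n % 3 = 0 ∨ n % 3 = 1 ∨ n % 3 = 2 := by omega
    rcases this with h | h | h
    · exact ⟨(n - 3) / 3, 3, by omega, by omega, by omega, by omega⟩
    · exact ⟨(n - 1) / 3, 1, by omega, by omega, by omega, by omega⟩
    · exact ⟨(n - 5) / 3, 5, by omega, by omega, by omega, by omega⟩
  exact thirty_of_truncated (Nat.odd_iff.2 hm) (Nat.odd_iff.2 hr) hrm (hn.trans e)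

end HasTriangleDecomposition

theorem mainTheorem2 (v : ℕ) (hmod : v ≡ 1 [MOD 150]) (hv1 : v ≠ 1) (hv301 : v ≠ 301) :
    ∃ (X : Type) (𝒜 : Set (Matrix (Fin 3) (Fin 5) X)),
      IsSplittingDesign 2 v 3 5 1 X 𝒜 := by
  obtain ⟨u, rfl⟩ : ∃ u, v = 150 * u + 1 := by
    have : v % 150 = 1 := hmod
    exact ⟨v / 150, by omega⟩
  have hfill : HasSplittingFamily (Option (Fin 30 × Fin 5)) := by
    obtain ⟨e⟩ := Finite.card_eq.1
      (show Nat.card (ZMod 151) = Nat.card (Option (Fin 30 × Fin 5)) by simp)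
    exact hasSplittingFamily_zmod_151.congr e
  have h : HasTriangleDecomposition (Fin u) (Fin 30) :=
    .thirty (by rw [Nat.card_fin]; omega) (by rw [Nat.card_fin]; omega)
  exact ⟨_, (h.hasSplittingFamily hfill).isSplittingDesign (by omega) (by simp; ring)⟩
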